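/- Let ${}_2F_1(\alpha,\beta;\gamma\,|\,z)=\sum_{k\ge 0}\frac{(\alpha)_k(\beta)_k}{(\gamma)_k\,k!}z^k$ (for $|z|<1$ and $\gamma\notin\{0,-1,-2,\dots\}$) be the Gauss hypergeometric function. Then for every complex number $a$ such that $\tfrac32-2a\notin\{0,-1,-2,\dots\}$, $$ {}_2F_1\left(a,a+\frac12;\frac32-2a\,\Big|\,-\frac13\right) =\frac{\Gamma\left(\frac23-2a\right)\Gamma(2-4a)}{6^{2a}\,\Gamma\left(\frac23\right)\Gamma(2-6a)} =\left(\frac98\right)^{2a}\cdot\frac{2\,\Gamma\left(\frac32-2a\right)\Gamma\left(\frac43\right)}{\sqrt{\pi}\;\Gamma\left(\frac43-2a\right)}. $$ Here $1/\Gamma$ is taken to be $0$ at the poles of $\Gamma$, powers of positive numbers are principal, and at those $a$ where $\Gamma(\frac23-2a)$ or $\Gamma(2-4a)$ has a pole the middle expression has a removable singularity and is understood as its limit. -/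

import Mathlib

open scoped Topology

/-! Dividing the series by `Γ(3/2 - 2a)` makes it an entire function of `a`, so it suffices to
evaluate it for `Re a < 0` and apply the identity theorem.

There put `s = -2a` and consider `∫ (1 - t²)^s (1 + xt)^s` over `[-1, 1]`, where `x² = -1/3`.
Expanding `(1 + xt)^s` binomially kills the odd terms, and the even ones are Beta integrals that
rebuild the regularised series (`integral_one_sub_sq_cpow_mul_one_add_cpow`). On the other hand, the
cubic `(1 - t²)(1 + xt)` is `8/9` times `1 - z³` restricted to the chord joining the two primitive
cube roots of unity. By Cauchy's theorem the chord may be replaced by two radii; `1 - z³` is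
invariant under rotation by a cube root of unity, so both radii give the single Beta integral `∫ (1
- r³)^s` over `[0, 1]` (`integral_one_sub_cube_cpow_segment`). Comparing the two evaluations gives
the second closed form.

The first closed form is the second one rewritten by the duplication and triplication formulas for
`Γ`. The triplication formula is obtained from the Bohr–Mollerup theorem. -/

/-! ### The regularised series is entire in the parameter -/

/-- The `k`-th term of the regularised series `₂F₁(a, a + 1/2; 3/2 - 2a; -1/3) / Γ(3/2 - 2a)`. -/
noncomputable def regularizedTerm (k : ℕ) (a : ℂ) : ℂ :=
  ((k.factorial : ℂ)⁻¹ * (ascPochhammer ℂ k).eval a * (ascPochhammer ℂ k).eval (a + 1 / 2)) *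
    (-1 / 3) ^ k * (Complex.Gamma (3 / 2 - 2 * a + k))⁻¹

theorem differentiable_regularizedTerm (k : ℕ) : Differentiable ℂ (regularizedTerm k) := by
  have h1 : Differentiable ℂ fun a : ℂ => (Complex.Gamma (3 / 2 - 2 * a + k))⁻¹ :=
    Complex.differentiable_one_div_Gamma.comp (by fun_prop)
  have h2 : Differentiable ℂ fun a : ℂ => (ascPochhammer ℂ k).eval a :=
    (ascPochhammer ℂ k).differentiable
  have h3 : Differentiable ℂ fun a : ℂ => (ascPochhammer ℂ k).eval (a + 1 / 2) :=
    (ascPochhammer ℂ k).differentiable.comp (by fun_prop)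
  unfold regularizedTerm
  fun_prop

theorem regularizedTerm_succ (k : ℕ) (a : ℂ) (h : 3 / 2 - 2 * a + k ≠ 0) :
    regularizedTerm (k + 1) a =
      regularizedTerm k a * ((a + k) * (a + 1 / 2 + k) / ((k + 1) * (3 / 2 - 2 * a + k)) *
        (-1 / 3)) := by
  have hk : (k : ℂ) + 1 ≠ 0 := by exact_mod_cast k.succ_ne_zero
  have hf : (k.factorial : ℂ) ≠ 0 := by exact_mod_cast k.factorial_ne_zero
  rw [regularizedTerm, regularizedTerm, Complex.one_div_Gamma_eq_self_mul_one_div_Gamma_add_one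
    (3 / 2 - 2 * a + k), ascPochhammer_succ_eval, ascPochhammer_succ_eval, Nat.factorial_succ]
  push_cast
  rw [← add_assoc]
  generalize (Complex.Gamma (3 / 2 - 2 * a + k + 1))⁻¹ = G
  generalize 3 / 2 - 2 * a + (k : ℂ) = c at h ⊢
  field_simp
  ring

/-- The term ratio tends to `1/3` in norm; the constant `20` makes `k` large enough, uniformly on
`‖a‖ ≤ R`, for it to be at most `1/2`. -/
theorem norm_regularizedTerm_succ_le {k : ℕ} {a : ℂ} {R : ℝ} (hR : 0 ≤ R) (ha : ‖a‖ ≤ R)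
    (hk : 20 * (R + 1) ≤ k) :
    ‖regularizedTerm (k + 1) a‖ ≤ ‖regularizedTerm k a‖ * (1 / 2) := by
  have h1 : ‖a + k‖ ≤ k + (R + 1) := by
    have := norm_add_le a (k : ℂ)
    simp only [Complex.norm_natCast] at this
    linarith
  have h2 : ‖a + 1 / 2 + k‖ ≤ k + (R + 1) := by
    have := norm_add_le (a + 1 / 2) (k : ℂ)
    have h' := norm_add_le a (1 / 2 : ℂ)
    simp only [Complex.norm_natCast] at this
    norm_num at h'
    linarith
  have h3 : (k : ℝ) - 2 * (R + 1) ≤ ‖3 / 2 - 2 * a + k‖ := by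
    have := norm_sub_norm_le (k : ℂ) (2 * a - 3 / 2)
    have h' := norm_sub_le (2 * a) (3 / 2 : ℂ)
    have h'' : ‖2 * a‖ = 2 * ‖a‖ := by simp
    rw [show (k : ℂ) - (2 * a - 3 / 2) = 3 / 2 - 2 * a + k by ring] at this
    simp only [Complex.norm_natCast] at this
    norm_num at h' h''
    linarith
  have hpos : 0 < ‖3 / 2 - 2 * a + k‖ := by linarith
  rw [regularizedTerm_succ k a (norm_pos_iff.1 hpos), norm_mul]
  refine mul_le_mul_of_nonneg_left ?_ (norm_nonneg _)
  have h4 : ‖(k : ℂ) + 1‖ = k + 1 := by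
    have := Complex.norm_natCast (k + 1)
    push_cast at this
    exact this
  rw [norm_mul, norm_div, norm_mul, norm_mul, h4]
  have h5 : ‖(-1 / 3 : ℂ)‖ = 1 / 3 := by norm_num
  rw [h5, div_mul_eq_mul_div, div_le_iff₀ (by positivity)]
  have h6 : ‖a + k‖ * ‖a + 1 / 2 + k‖ ≤ (k + (R + 1)) * (k + (R + 1)) := by gcongr
  have h7 : (k + 1) * ((k : ℝ) - 2 * (R + 1)) ≤ (k + 1) * ‖3 / 2 - 2 * a + k‖ := by gcongr
  nlinarith

theorem norm_regularizedTerm_add_le {k : ℕ} {a : ℂ} {R : ℝ} (hR : 0 ≤ R) (ha : ‖a‖ ≤ R)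
    (hk : 20 * (R + 1) ≤ k) (m : ℕ) :
    ‖regularizedTerm (m + k) a‖ ≤ ‖regularizedTerm k a‖ * (1 / 2) ^ m := by
  induction m with
  | zero => simp
  | succ m ih =>
    have h := norm_regularizedTerm_succ_le (k := m + k) hR ha (by push_cast; linarith)
    rw [add_right_comm, pow_succ]
    linarith

theorem differentiable_tsum_regularizedTerm :
    Differentiable ℂ fun a => ∑' k, regularizedTerm k a := by
  intro a₀
  set R : ℝ := ‖a₀‖ + 1
  have hR : 0 ≤ R := by positivity
  obtain ⟨K, hK⟩ := exists_nat_ge (20 * (R + 1))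
  obtain ⟨M, hM⟩ := (isCompact_closedBall (0 : ℂ) R).exists_bound_of_continuousOn
    (differentiable_regularizedTerm K).continuous.continuousOn
  have hb : ∀ (m : ℕ) (a : ℂ), a ∈ Metric.ball (0 : ℂ) R →
      ‖regularizedTerm (m + K) a‖ ≤ M * (1 / 2) ^ m := by
    intro m a ha
    have ha' : a ∈ Metric.closedBall (0 : ℂ) R := Metric.ball_subset_closedBall ha
    refine (norm_regularizedTerm_add_le hR (by simpa using ha') hK m).trans ?_
    gcongr
    exact hM a ha'
  have hs : Summable fun m : ℕ => M * (1 / 2 : ℝ) ^ m := summable_geometric_two.mul_left M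
  have htail := Complex.differentiableOn_tsum_of_summable_norm hs
    (fun m => (differentiable_regularizedTerm (m + K)).differentiableOn) Metric.isOpen_ball hb
  have hfin : Differentiable ℂ fun a => ∑ k ∈ Finset.range K, regularizedTerm k a :=
    Differentiable.fun_sum fun k _ => differentiable_regularizedTerm k
  have hmem : Metric.ball (0 : ℂ) R ∈ 𝓝 a₀ :=
    Metric.isOpen_ball.mem_nhds (by simp [R])
  refine ((hfin a₀).add (htail.differentiableAt hmem)).congr_of_eventuallyEq ?_
  filter_upwards [hmem] with a ha
  exact (Summable.sum_add_tsum_nat_add K ((summable_nat_add_iff K).1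
    (hs.of_norm_bounded fun m => hb m a ha))).symm

theorem Gamma_inv_mul_hypergeometric_eq_tsum (a : ℂ) (hc : ∀ k : ℕ, 3 / 2 - 2 * a ≠ -(k : ℂ)) :
    (Complex.Gamma (3 / 2 - 2 * a))⁻¹ * ₂F₁ a (a + 1 / 2) (3 / 2 - 2 * a) (-1 / 3 : ℂ) =
      ∑' k, regularizedTerm k a := by
  -- `1/Γ(c) = (c)_k / Γ(c + k)`, from iterating the functional equation of `1/Γ`, which has no
  -- exceptional points.
  have hG : ∀ k : ℕ, (Complex.Gamma (3 / 2 - 2 * a))⁻¹ =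
      (ascPochhammer ℂ k).eval (3 / 2 - 2 * a) * (Complex.Gamma (3 / 2 - 2 * a + k))⁻¹ := by
    intro k
    induction k with
    | zero => simp
    | succ k ih =>
      rw [ih, Complex.one_div_Gamma_eq_self_mul_one_div_Gamma_add_one (3 / 2 - 2 * a + k),
        ascPochhammer_succ_eval]
      push_cast
      ring_nf
  rw [ordinaryHypergeometric_eq_tsum, ← tsum_mul_left]
  refine tsum_congr fun k => ?_
  have hne : (ascPochhammer ℂ k).eval (3 / 2 - 2 * a) ≠ 0 := by
    rw [Ne, ascPochhammer_eval_eq_zero_iff]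
    rintro ⟨j, -, hj⟩
    exact hc j (by rw [hj, neg_neg])
  rw [hG k, regularizedTerm, smul_eq_mul, mul_right_comm]
  generalize (ascPochhammer ℂ k).eval (3 / 2 - 2 * a) = P at hne ⊢
  linear_combination ((k.factorial : ℂ)⁻¹ * (ascPochhammer ℂ k).eval a *
    (ascPochhammer ℂ k).eval (a + 1 / 2) * (-1 / 3) ^ k *
    (Complex.Gamma (3 / 2 - 2 * a + k))⁻¹) * mul_inv_cancel₀ hne

/-! ### Gauss's multiplication formula for three factors -/

/-- The function which the tripling formula identifies with `Γ` on the positive reals. -/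
noncomputable def triplingGamma (s : ℝ) : ℝ :=
  Real.Gamma (s / 3) * Real.Gamma (s / 3 + 1 / 3) * Real.Gamma (s / 3 + 2 / 3) * 3 ^ (s - 1) /
    (Real.Gamma (1 / 3) * Real.Gamma (2 / 3))

theorem triplingGamma_add_one (s : ℝ) (hs : s ≠ 0) :
    triplingGamma (s + 1) = s * triplingGamma s := by
  rw [triplingGamma, triplingGamma, show s + 1 - 1 = s - 1 + 1 by ring,
    show (s + 1) / 3 = s / 3 + 1 / 3 by ring, show s / 3 + 1 / 3 + 1 / 3 = s / 3 + 2 / 3 by ring,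
    show s / 3 + 1 / 3 + 2 / 3 = s / 3 + 1 by ring,
    Real.Gamma_add_one (div_ne_zero hs three_ne_zero), Real.rpow_add three_pos, Real.rpow_one]
  ring

theorem triplingGamma_one : triplingGamma 1 = 1 := by
  have h1 : Real.Gamma (1 / 3) ≠ 0 := (Real.Gamma_pos_of_pos (by norm_num)).ne'
  have h2 : Real.Gamma (2 / 3) ≠ 0 := (Real.Gamma_pos_of_pos (by norm_num)).ne'
  rw [triplingGamma, show (1 / 3 : ℝ) + 2 / 3 = 1 by norm_num,
    show (1 / 3 : ℝ) + 1 / 3 = 2 / 3 by norm_num, Real.Gamma_one, sub_self, Real.rpow_zero]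
  field_simp

theorem convexOn_log_Gamma_div_three_add {c : ℝ} (hc : 0 ≤ c) :
    ConvexOn ℝ (Set.Ioi (0 : ℝ)) fun s => Real.log (Real.Gamma (s / 3 + c)) := by
  refine ⟨convex_Ioi 0, fun x hx y hy u v hu hv huv => ?_⟩
  have h := Real.convexOn_log_Gamma.2 (x := x / 3 + c) (y := y / 3 + c)
    (add_pos_of_pos_of_nonneg (div_pos hx three_pos) hc)
    (add_pos_of_pos_of_nonneg (div_pos hy three_pos) hc) hu hv huv
  simp only [Function.comp_apply, smul_eq_mul] at h ⊢
  rwa [show u * (x / 3 + c) + v * (y / 3 + c) = (u * x + v * y) / 3 + c by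
    linear_combination c * huv] at h

theorem convexOn_log_triplingGamma :
    ConvexOn ℝ (Set.Ioi (0 : ℝ)) (Real.log ∘ triplingGamma) := by
  have hlin : ConvexOn ℝ (Set.Ioi (0 : ℝ)) fun s : ℝ => Real.log 3 * s := by
    simpa using (convexOn_id (convex_Ioi (0 : ℝ))).smul (Real.log_pos (by norm_num : (1 : ℝ) < 3)).le
  refine (((((convexOn_log_Gamma_div_three_add le_rfl).add
    (convexOn_log_Gamma_div_three_add (c := 1 / 3) (by norm_num))).add
    (convexOn_log_Gamma_div_three_add (c := 2 / 3) (by norm_num))).add hlin).add_const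
    (-Real.log 3 - Real.log (Real.Gamma (1 / 3) * Real.Gamma (2 / 3)))).congr ?_
  intro s hs
  have hs : 0 < s := hs
  have g1 : 0 < Real.Gamma (s / 3) := Real.Gamma_pos_of_pos (by positivity)
  have g2 : 0 < Real.Gamma (s / 3 + 1 / 3) := Real.Gamma_pos_of_pos (by positivity)
  have g3 : 0 < Real.Gamma (s / 3 + 2 / 3) := Real.Gamma_pos_of_pos (by positivity)
  have g4 : 0 < Real.Gamma (1 / 3) := Real.Gamma_pos_of_pos (by norm_num)
  have g5 : 0 < Real.Gamma (2 / 3) := Real.Gamma_pos_of_pos (by norm_num)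
  have g6 : (0 : ℝ) < 3 ^ (s - 1) := Real.rpow_pos_of_pos three_pos _
  simp only [Function.comp_apply, Pi.add_apply, triplingGamma, add_zero]
  rw [Real.log_div (by positivity) (by positivity), Real.log_mul (by positivity) g6.ne',
    Real.log_mul (by positivity) g3.ne', Real.log_mul g1.ne' g2.ne', Real.log_rpow three_pos]
  ring

/-- Bohr–Mollerup: positivity, log-convexity, the functional equation and the value at `1` determine
`Γ` on the positive reals. -/
theorem triplingGamma_eq_Gamma {s : ℝ} (hs : 0 < s) : triplingGamma s = Real.Gamma s := by
  refine Real.eq_Gamma_of_log_convex convexOn_log_triplingGamma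
    (fun {y} hy => triplingGamma_add_one y hy.ne') (fun {y} hy => ?_) triplingGamma_one hs
  have g1 : 0 < Real.Gamma (y / 3) := Real.Gamma_pos_of_pos (by positivity)
  have g2 : 0 < Real.Gamma (y / 3 + 1 / 3) := Real.Gamma_pos_of_pos (by positivity)
  have g3 : 0 < Real.Gamma (y / 3 + 2 / 3) := Real.Gamma_pos_of_pos (by positivity)
  have g4 : 0 < Real.Gamma (1 / 3) := Real.Gamma_pos_of_pos (by norm_num)
  have g5 : 0 < Real.Gamma (2 / 3) := Real.Gamma_pos_of_pos (by norm_num)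
  unfold triplingGamma
  positivity

theorem Real.Gamma_mul_Gamma_add_third_mul_Gamma_add_two_thirds_of_pos {s : ℝ} (hs : 0 < s) :
    Real.Gamma s * Real.Gamma (s + 1 / 3) * Real.Gamma (s + 2 / 3) =
      Real.Gamma (3 * s) * 3 ^ (1 - 3 * s) * (Real.Gamma (1 / 3) * Real.Gamma (2 / 3)) := by
  have g4 : 0 < Real.Gamma (1 / 3) := Real.Gamma_pos_of_pos (by norm_num)
  have g5 : 0 < Real.Gamma (2 / 3) := Real.Gamma_pos_of_pos (by norm_num)
  have g6 : (0 : ℝ) < 3 ^ (3 * s - 1) := Real.rpow_pos_of_pos three_pos _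
  rw [← triplingGamma_eq_Gamma (mul_pos three_pos hs), triplingGamma,
    mul_div_cancel_left₀ _ (three_ne_zero' ℝ), show 1 - 3 * s = -(3 * s - 1) by ring,
    Real.rpow_neg zero_le_three]
  field_simp

/-- Gauss's multiplication formula for `Γ` with three factors. -/
theorem Complex.Gamma_mul_Gamma_add_third_mul_Gamma_add_two_thirds (s : ℂ) :
    Complex.Gamma s * Complex.Gamma (s + 1 / 3) * Complex.Gamma (s + 2 / 3) =
      Complex.Gamma (3 * s) * 3 ^ (1 - 3 * s) *
        (Complex.Gamma (1 / 3) * Complex.Gamma (2 / 3)) := by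
  -- Passing to reciprocals makes both sides entire, so agreement on positive reals accumulating at
  -- `1` is enough.
  suffices (fun z => (Complex.Gamma z)⁻¹ * (Complex.Gamma (z + 1 / 3))⁻¹ *
      (Complex.Gamma (z + 2 / 3))⁻¹) = fun z => (Complex.Gamma (3 * z))⁻¹ *
      (3 : ℂ) ^ (3 * z - 1) * (Complex.Gamma (1 / 3) * Complex.Gamma (2 / 3))⁻¹ by
    have h := congr_arg Inv.inv (congr_fun this s)
    simp only [mul_inv, inv_inv] at h
    rwa [← Complex.cpow_neg, neg_sub] at h
  have hG := Complex.differentiable_one_div_Gamma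
  have h1 : AnalyticOnNhd ℂ (fun z : ℂ => (Complex.Gamma z)⁻¹ * (Complex.Gamma (z + 1 / 3))⁻¹ *
      (Complex.Gamma (z + 2 / 3))⁻¹) Set.univ := by
    refine DifferentiableOn.analyticOnNhd (Differentiable.differentiableOn ?_) isOpen_univ
    exact (hG.mul (hG.comp (differentiable_id.add_const (1 / 3)))).mul
      (hG.comp (differentiable_id.add_const (2 / 3)))
  have h2 : AnalyticOnNhd ℂ (fun z => (Complex.Gamma (3 * z))⁻¹ * (3 : ℂ) ^ (3 * z - 1) *
      (Complex.Gamma (1 / 3) * Complex.Gamma (2 / 3))⁻¹) Set.univ := by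
    refine DifferentiableOn.analyticOnNhd (Differentiable.differentiableOn ?_) isOpen_univ
    refine Differentiable.mul_const (Differentiable.mul ?_ ?_) _
    · exact hG.comp (differentiable_id.const_mul 3)
    · exact fun t => DifferentiableAt.const_cpow (by fun_prop) (Or.inl three_ne_zero)
  have h3 : Filter.Tendsto ((↑) : ℝ → ℂ) (𝓝[≠] 1) (𝓝[≠] 1) := by
    rw [tendsto_nhdsWithin_iff]
    exact ⟨tendsto_nhdsWithin_of_tendsto_nhds Complex.continuous_ofReal.continuousAt,
      eventually_nhdsWithin_iff.mpr
        (Filter.Eventually.of_forall fun t ht => Complex.ofReal_ne_one.mpr ht)⟩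
  refine AnalyticOnNhd.eq_of_frequently_eq h1 h2 (h3.frequently ?_)
  refine ((Filter.Eventually.filter_mono nhdsWithin_le_nhds) ?_).frequently
  filter_upwards [eventually_gt_nhds zero_lt_one] with t ht
  have h := congr_arg (fun x : ℝ => (x : ℂ)⁻¹)
    (Real.Gamma_mul_Gamma_add_third_mul_Gamma_add_two_thirds_of_pos ht)
  simp only [Complex.ofReal_mul, ← Complex.Gamma_ofReal, Complex.ofReal_cpow zero_le_three] at h
  push_cast at h
  simp only [mul_inv, ← Complex.cpow_neg, neg_sub] at h ⊢
  exact h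

/-! ### Cauchy's theorem up to the boundary of the disc -/

/-- Cauchy's theorem on the triangle `0, p, q` in the closed unit disc, for a function which is
continuous there and holomorphic in the interior of the disc. -/
theorem integral_segment_eq_sub_of_differentiableOn_ball {f : ℂ → ℂ}
    (hc : ContinuousOn f (Metric.closedBall 0 1)) (hd : DifferentiableOn ℂ f (Metric.ball 0 1))
    {p q : ℂ} (hp : ‖p‖ ≤ 1) (hq : ‖q‖ ≤ 1) :
    (q - p) * ∫ t in (0 : ℝ)..1, f (p + t * (q - p)) =
      q * (∫ r in (0 : ℝ)..1, f (r * q)) - p * ∫ r in (0 : ℝ)..1, f (r * p) := by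
  obtain ⟨F, hF⟩ := hd.isExactOn_ball
  have hseg : ∀ {u v : ℂ}, ‖u‖ ≤ 1 → ‖v‖ ≤ 1 → ∀ t ∈ Set.Icc (0 : ℝ) 1,
      ‖u + t * (v - u)‖ ≤ 1 := by
    intro u v hu hv t ht
    have h := (convex_closedBall (0 : ℂ) 1).add_smul_sub_mem (x := u) (y := v)
      (by simpa using hu) (by simpa using hv) ht
    simpa using h
  -- The primitive `F` exists only in the open disc, so segments are first shrunk by `ρ < 1`; `hlim`
  -- then lets `ρ → 1` by dominated convergence.
  have hinner : ∀ {u v : ℂ}, ‖u‖ ≤ 1 → ‖v‖ ≤ 1 → ∀ ρ ∈ Set.Ico (0 : ℝ) 1,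
      ρ * (v - u) * ∫ t in (0 : ℝ)..1, f (ρ * (u + t * (v - u))) = F (ρ * v) - F (ρ * u) := by
    intro u v hu hv ρ hρ
    have hmem : ∀ t ∈ Set.Icc (0 : ℝ) 1, (ρ * (u + t * (v - u)) : ℂ) ∈ Metric.ball (0 : ℂ) 1 := by
      intro t ht
      have h := hseg hu hv t ht
      rw [mem_ball_zero_iff, norm_mul, Complex.norm_real, Real.norm_of_nonneg hρ.1]
      nlinarith [hρ.1, hρ.2]
    have hlin : ∀ t : ℝ, HasDerivAt (fun t : ℝ => (ρ * (u + t * (v - u)) : ℂ)) (ρ * (v - u)) t := by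
      intro t
      simpa using (((Complex.ofRealCLM.hasDerivAt (x := t)).mul_const (v - u)).const_add u).const_mul
        (ρ : ℂ)
    rw [← intervalIntegral.integral_const_mul, intervalIntegral.integral_eq_sub_of_hasDerivAt
      (f := fun t : ℝ => F (ρ * (u + t * (v - u))))]
    · simp
    · intro t ht
      rw [Set.uIcc_of_le zero_le_one] at ht
      have := (hF _ (hmem t ht)).comp t (hlin t)
      rwa [mul_comm] at this
    · refine ContinuousOn.intervalIntegrable (ContinuousOn.mul continuousOn_const ?_)
      rw [Set.uIcc_of_le zero_le_one]
      exact hd.continuousOn.comp (by fun_prop) hmem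
  obtain ⟨C, hC⟩ := (isCompact_closedBall (0 : ℂ) 1).exists_bound_of_continuousOn hc
  have hlim : ∀ {u v : ℂ}, ‖u‖ ≤ 1 → ‖v‖ ≤ 1 →
      Filter.Tendsto (fun ρ : ℝ => ρ * (v - u) * ∫ t in (0 : ℝ)..1, f (ρ * (u + t * (v - u))))
        (𝓝[Set.Ico 0 1] 1) (𝓝 ((v - u) * ∫ t in (0 : ℝ)..1, f (u + t * (v - u)))) := by
    intro u v hu hv
    have hmem : ∀ ρ ∈ Set.Icc (0 : ℝ) 1, ∀ t ∈ Set.Icc (0 : ℝ) 1,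
        (ρ * (u + t * (v - u)) : ℂ) ∈ Metric.closedBall (0 : ℂ) 1 := by
      intro ρ hρ t ht
      have h := hseg hu hv t ht
      rw [mem_closedBall_zero_iff, norm_mul, Complex.norm_real, Real.norm_of_nonneg hρ.1]
      nlinarith [hρ.1, hρ.2, norm_nonneg (u + t * (v - u))]
    have hcont : ContinuousWithinAt
        (fun ρ : ℝ => ∫ t in (0 : ℝ)..1, f (ρ * (u + t * (v - u)))) (Set.Icc 0 1) 1 := by
      refine intervalIntegral.continuousWithinAt_of_dominated_interval (bound := fun _ => C)
        ?_ ?_ ?_ ?_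
      · filter_upwards [self_mem_nhdsWithin] with ρ hρ
        rw [Set.uIoc_of_le zero_le_one]
        refine ContinuousOn.aestronglyMeasurable ?_ measurableSet_Ioc
        exact hc.comp (by fun_prop) fun t ht => hmem ρ hρ t (Set.Ioc_subset_Icc_self ht)
      · filter_upwards [self_mem_nhdsWithin] with ρ hρ
        refine Filter.Eventually.of_forall fun t ht => ?_
        rw [Set.uIoc_of_le zero_le_one] at ht
        exact hC _ (hmem ρ hρ t (Set.Ioc_subset_Icc_self ht))
      · exact intervalIntegrable_const
      · refine Filter.Eventually.of_forall fun t ht => ?_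
        rw [Set.uIoc_of_le zero_le_one] at ht
        have hm := fun ρ hρ => hmem ρ hρ t (Set.Ioc_subset_Icc_self ht)
        exact (hc.comp (f := fun ρ : ℝ => (ρ * (u + t * (v - u)) : ℂ)) (by fun_prop) hm) 1 (by simp)
    have h1 : ContinuousWithinAt (fun ρ : ℝ => (ρ * (v - u) : ℂ)) (Set.Icc 0 1) 1 := by fun_prop
    have h := (h1.mul hcont).mono_left (nhdsWithin_mono 1 Set.Ico_subset_Icc_self)
    simpa [Pi.mul_def] using h
  have hne : (𝓝[Set.Ico (0 : ℝ) 1] 1).NeBot := by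
    rw [nhdsWithin_Ico_eq_nhdsLT zero_lt_one]
    infer_instance
  have h0 : ‖(0 : ℂ)‖ ≤ 1 := by simp
  have hR := (hlim h0 hq).sub (hlim h0 hp)
  refine tendsto_nhds_unique ((hlim hp hq).congr' ?_) (by simpa using hR)
  filter_upwards [self_mem_nhdsWithin] with ρ hρ
  have e1 := hinner hp hq ρ hρ
  have e2 := hinner h0 hq ρ hρ
  have e3 := hinner h0 hp ρ hρ
  simp only [sub_zero, zero_add] at e2 e3
  rw [e1, e2, e3]
  ring

/-! ### Beta integrals -/

/-- Substitute `y = r ^ p`. The indicator of `(0, 1]` carries the integrals to the half-line, where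
the change of variables needs no integrability. -/
theorem integral_pow_mul_one_sub_pow_cpow (n : ℕ) {p : ℕ} (hp : 0 < p) (s : ℂ) :
    ∫ r in (0 : ℝ)..1, (r : ℂ) ^ n * (1 - (r : ℂ) ^ p) ^ s =
      (p : ℂ)⁻¹ * Complex.betaIntegral (((n + 1 : ℝ) / p : ℝ) : ℂ) (s + 1) := by
  have hp' : (0 : ℝ) < p := by exact_mod_cast hp
  set u : ℝ := (n + 1 : ℝ) / p with hu
  set g : ℝ → ℂ := fun y => (y : ℂ) ^ ((u : ℂ) - 1) * (1 - (y : ℂ)) ^ (s + 1 - 1) with hg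
  have h := MeasureTheory.integral_comp_rpow_Ioi_of_pos (g := (Set.Ioc (0 : ℝ) 1).indicator g) hp'
  rw [MeasureTheory.setIntegral_indicator measurableSet_Ioc,
    Set.inter_eq_self_of_subset_right Set.Ioc_subset_Ioi_self] at h
  have hL : ∫ r in Set.Ioc (0 : ℝ) 1, (r : ℂ) ^ n * (1 - (r : ℂ) ^ p) ^ s =
      ∫ r in Set.Ioi (0 : ℝ), (Set.Ioc (0 : ℝ) 1).indicator
        (fun r : ℝ => (r : ℂ) ^ n * (1 - (r : ℂ) ^ p) ^ s) r := by
    rw [MeasureTheory.setIntegral_indicator measurableSet_Ioc,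
      Set.inter_eq_self_of_subset_right Set.Ioc_subset_Ioi_self]
  rw [Complex.betaIntegral, intervalIntegral.integral_of_le zero_le_one,
    intervalIntegral.integral_of_le zero_le_one, ← h, hL, ← MeasureTheory.integral_const_mul]
  refine MeasureTheory.setIntegral_congr_fun measurableSet_Ioi fun x hx => ?_
  have hx : 0 < x := hx
  by_cases hx1 : x ≤ 1
  · have hm : x ^ (p : ℝ) ∈ Set.Ioc (0 : ℝ) 1 :=
      ⟨Real.rpow_pos_of_pos hx _, Real.rpow_le_one hx.le hx1 hp'.le⟩
    have hpow : x ^ ((p : ℝ) - 1) * (x ^ (p : ℝ)) ^ (u - 1) = x ^ n := by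
      rw [← Real.rpow_mul hx.le, ← Real.rpow_add hx, ← Real.rpow_natCast]
      congr 1
      rw [hu]
      field_simp
      ring
    have hpow' : ((x ^ ((p : ℝ) - 1) : ℝ) : ℂ) * ((x ^ (p : ℝ) : ℝ) : ℂ) ^ ((u : ℂ) - 1) =
        (x : ℂ) ^ n := by
      rw [← Complex.ofReal_pow, ← hpow, Complex.ofReal_mul, Complex.ofReal_cpow hm.1.le]
      push_cast
      rfl
    rw [Set.indicator_of_mem hm, Set.indicator_of_mem (Set.mem_Ioc.2 ⟨hx, hx1⟩), hg, add_sub_cancel_right,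
      Complex.real_smul, Complex.ofReal_mul, ← hpow', Real.rpow_natCast]
    have hpc : (p : ℂ) ≠ 0 := by exact_mod_cast hp.ne'
    push_cast
    field_simp
  · have hm : x ^ (p : ℝ) ∉ Set.Ioc (0 : ℝ) 1 := fun h' =>
      absurd h'.2 (not_le.2 (Real.one_lt_rpow (not_le.1 hx1) hp'))
    rw [Set.indicator_of_notMem hm, Set.indicator_of_notMem fun h' => hx1 h'.2]
    simp

theorem continuousOn_one_sub_sq_cpow {s : ℂ} (hs : 0 < s.re) :
    ContinuousOn (fun t : ℝ => (1 - (t : ℂ) ^ 2) ^ s) (Set.Icc (-1) 1) := by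
  intro t ht
  refine ContinuousAt.continuousWithinAt (ContinuousAt.comp (f := fun t : ℝ => 1 - (t : ℂ) ^ 2)
    (Complex.continuousAt_cpow_const_of_re_pos (Or.inl ?_) hs) (by fun_prop))
  rw [← Complex.ofReal_pow, ← Complex.ofReal_one, ← Complex.ofReal_sub, Complex.ofReal_re]
  nlinarith [ht.1, ht.2]

theorem intervalIntegrable_pow_mul_one_sub_sq_cpow {s : ℂ} (hs : 0 < s.re) (n : ℕ) {u v : ℝ}
    (hu : u ∈ Set.Icc (-1 : ℝ) 1) (hv : v ∈ Set.Icc (-1 : ℝ) 1) :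
    IntervalIntegrable (fun t : ℝ => (t : ℂ) ^ n * (1 - (t : ℂ) ^ 2) ^ s)
      MeasureTheory.volume u v := by
  refine ContinuousOn.intervalIntegrable (ContinuousOn.mul (by fun_prop) ?_)
  exact (continuousOn_one_sub_sq_cpow hs).mono (Set.uIcc_subset_Icc hu hv)

theorem integral_pow_mul_one_sub_sq_cpow {s : ℂ} (hs : 0 < s.re) (n : ℕ) :
    ∫ t in (-1 : ℝ)..1, (t : ℂ) ^ n * (1 - (t : ℂ) ^ 2) ^ s =
      (1 + (-1) ^ n) * ∫ t in (0 : ℝ)..1, (t : ℂ) ^ n * (1 - (t : ℂ) ^ 2) ^ s := by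
  have h0 : (0 : ℝ) ∈ Set.Icc (-1 : ℝ) 1 := by norm_num
  have h1 : (1 : ℝ) ∈ Set.Icc (-1 : ℝ) 1 := by norm_num
  have h2 : (-1 : ℝ) ∈ Set.Icc (-1 : ℝ) 1 := by norm_num
  have hneg : ∫ t in (-1 : ℝ)..0, (t : ℂ) ^ n * (1 - (t : ℂ) ^ 2) ^ s =
      (-1) ^ n * ∫ t in (0 : ℝ)..1, (t : ℂ) ^ n * (1 - (t : ℂ) ^ 2) ^ s := by
    have h := intervalIntegral.integral_comp_neg (a := 0) (b := 1)
      (fun t : ℝ => (t : ℂ) ^ n * (1 - (t : ℂ) ^ 2) ^ s)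
    rw [neg_zero] at h
    rw [← h, ← intervalIntegral.integral_const_mul]
    congr 1
    ext t
    push_cast
    rw [neg_pow (t : ℂ) n, neg_sq, mul_assoc]
  rw [← intervalIntegral.integral_add_adjacent_intervals
    (intervalIntegrable_pow_mul_one_sub_sq_cpow hs n h2 h0)
    (intervalIntegrable_pow_mul_one_sub_sq_cpow hs n h0 h1), hneg]
  ring

theorem integral_even_pow_mul_one_sub_sq_cpow {s : ℂ} (hs : 0 < s.re) (k : ℕ) :
    ∫ t in (-1 : ℝ)..1, (t : ℂ) ^ (2 * k) * (1 - (t : ℂ) ^ 2) ^ s =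
      Complex.Gamma (k + 1 / 2) * Complex.Gamma (s + 1) / Complex.Gamma (3 / 2 + s + k) := by
  rw [integral_pow_mul_one_sub_sq_cpow hs, integral_pow_mul_one_sub_pow_cpow _ two_pos,
    Complex.betaIntegral_eq_Gamma_mul_div]
  · rw [pow_mul, neg_one_sq, one_pow]
    push_cast
    rw [show ((2 * k + 1 : ℂ) / 2) = k + 1 / 2 by ring,
      show (k + 1 / 2 + (s + 1) : ℂ) = 3 / 2 + s + k by ring]
    ring
  · rw [Complex.ofReal_re]
    positivity
  · rw [Complex.add_re, Complex.one_re]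
    positivity

/-! ### First evaluation: binomial expansion -/

theorem Ring.choose_succ_eq_mul_div (s : ℂ) (n : ℕ) :
    Ring.choose s (n + 1) = Ring.choose s n * (s - n) / (n + 1) := by
  have hn : (n : ℂ) + 1 ≠ 0 := by exact_mod_cast n.succ_ne_zero
  have hf : (n.factorial : ℂ) ≠ 0 := by exact_mod_cast n.factorial_ne_zero
  rw [Ring.choose_eq_smul, Ring.choose_eq_smul, descPochhammer_succ_right, Nat.factorial_succ,
    Polynomial.smeval_mul, Polynomial.smeval_sub, Polynomial.smeval_X, Polynomial.smeval_natCast]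
  simp only [smul_eq_mul, pow_one, pow_zero, nsmul_eq_mul, mul_one]
  push_cast
  field_simp

/-- This is where the parameter pair `a, a + 1/2` comes from: `(2a)_{2k} = 4^k (a)_k (a + 1/2)_k`,
while `Γ(k + 1/2) = √π (2k)! / (4^k k!)`. -/
theorem choose_two_mul_mul_Gamma (a : ℂ) (k : ℕ) :
    Ring.choose (-2 * a) (2 * k) * Complex.Gamma (k + 1 / 2) =
      (Real.sqrt Real.pi : ℂ) * ((k.factorial : ℂ)⁻¹ * (ascPochhammer ℂ k).eval a *
        (ascPochhammer ℂ k).eval (a + 1 / 2)) := by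
  induction k with
  | zero =>
    have h := Complex.Gamma_one_half_eq
    rw [← Complex.ofReal_ofNat, ← Complex.ofReal_one, ← Complex.ofReal_div,
      ← Complex.ofReal_cpow Real.pi_pos.le, ← Real.sqrt_eq_rpow] at h
    push_cast at h
    simp [← h]
  | succ k ih =>
    have hk : (k : ℂ) + 1 ≠ 0 := by exact_mod_cast k.succ_ne_zero
    have hk2 : 2 * (k : ℂ) + 1 ≠ 0 := by exact_mod_cast (2 * k).succ_ne_zero
    have hf : (k.factorial : ℂ) ≠ 0 := by exact_mod_cast k.factorial_ne_zero
    have hk' : (k : ℂ) + 1 / 2 ≠ 0 := by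
      intro h
      exact hk2 (by linear_combination 2 * h)
    rw [show 2 * (k + 1) = 2 * k + 1 + 1 by ring, Ring.choose_succ_eq_mul_div,
      Ring.choose_succ_eq_mul_div, ascPochhammer_succ_eval, ascPochhammer_succ_eval,
      Nat.factorial_succ]
    push_cast
    rw [show (k + 1 + 1 / 2 : ℂ) = k + 1 / 2 + 1 by ring, Complex.Gamma_add_one _ hk']
    have hk3 : 2 * (k : ℂ) + 1 + 1 ≠ 0 := by
      intro h
      exact hk (by linear_combination h / 2)
    rw [mul_inv]
    have e : (-2 * a - 2 * k) / (2 * k + 1) * ((-2 * a - (2 * k + 1)) / (2 * k + 1 + 1)) *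
        (k + 1 / 2) = ((k : ℂ) + 1)⁻¹ * ((a + k) * (a + 1 / 2 + k)) := by
      rw [show 2 * (k : ℂ) + 1 + 1 = 2 * (k + 1) by ring]
      field_simp
      ring
    linear_combination ((-2 * a - 2 * k) / (2 * k + 1) *
      ((-2 * a - (2 * k + 1)) / (2 * k + 1 + 1)) * (k + 1 / 2)) * ih +
      ((Real.sqrt Real.pi : ℂ) * ((k.factorial : ℂ)⁻¹ * (ascPochhammer ℂ k).eval a *
        (ascPochhammer ℂ k).eval (a + 1 / 2))) * e

theorem binomialSeries_apply_const (s x : ℂ) (n : ℕ) :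
    (binomialSeries ℂ s n fun _ => x) = Ring.choose s n * x ^ n := by
  rw [binomialSeries_apply, List.ofFn_const, List.prod_replicate, smul_eq_mul]

theorem mem_eball_zero_one_iff {x : ℂ} : x ∈ Metric.eball (0 : ℂ) 1 ↔ ‖x‖ < 1 := by
  rw [← ENNReal.ofReal_one, Metric.eball_ofReal, mem_ball_zero_iff]

theorem hasSum_one_add_cpow (s : ℂ) {x : ℂ} (hx : ‖x‖ < 1) :
    HasSum (fun n => Ring.choose s n * x ^ n) ((1 + x) ^ s) := by
  have h := (Complex.one_add_cpow_hasFPowerSeriesOnBall_zero (a := s)).hasSum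
    (mem_eball_zero_one_iff.2 hx)
  simpa only [binomialSeries_apply_const, zero_add] using h

theorem summable_norm_choose_mul_pow (s : ℂ) {x : ℂ} (hx : ‖x‖ < 1) :
    Summable fun n => ‖Ring.choose s n * x ^ n‖ := by
  have h := (binomialSeries ℂ s).summable_norm_apply
    (Metric.eball_subset_eball binomialSeries_radius_ge_one (mem_eball_zero_one_iff.2 hx))
  simpa only [binomialSeries_apply_const] using h

theorem integral_one_sub_sq_cpow_mul_one_add_cpow {a x : ℂ} (ha : a.re < 0)
    (hx : x ^ 2 = -1 / 3) :
    ∫ t in (-1 : ℝ)..1, (1 - (t : ℂ) ^ 2) ^ (-2 * a) * (1 + x * t) ^ (-2 * a) =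
      (Real.sqrt Real.pi : ℂ) * Complex.Gamma (1 - 2 * a) * ∑' k, regularizedTerm k a := by
  have hs : 0 < (-2 * a).re := by
    simp
    linarith
  set s := -2 * a with hsdef
  have hxn : ‖x‖ < 1 := by
    have h := congr_arg norm hx
    norm_num at h
    nlinarith [norm_nonneg x]
  obtain ⟨C, hC⟩ := isCompact_Icc.exists_bound_of_continuousOn (continuousOn_one_sub_sq_cpow hs)
  have hIoc : Set.uIoc (-1 : ℝ) 1 = Set.Ioc (-1) 1 := Set.uIoc_of_le (by norm_num)
  have hsum : HasSum (fun n => ∫ t in (-1 : ℝ)..1,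
      Ring.choose s n * x ^ n * ((t : ℂ) ^ n * (1 - (t : ℂ) ^ 2) ^ s))
      (∫ t in (-1 : ℝ)..1, (1 - (t : ℂ) ^ 2) ^ s * (1 + x * t) ^ s) := by
    refine intervalIntegral.hasSum_integral_of_dominated_convergence
      (fun n _ => ‖Ring.choose s n * x ^ n‖ * C) ?_ ?_ ?_ ?_ ?_
    · intro n
      exact ((intervalIntegrable_pow_mul_one_sub_sq_cpow hs n (by norm_num)
        (by norm_num)).const_mul _).aestronglyMeasurable_restrict_uIoc
    · refine fun n => Filter.Eventually.of_forall fun t ht => ?_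
      rw [hIoc] at ht
      have h1 : ‖(t : ℂ) ^ n‖ ≤ 1 := by
        rw [norm_pow, Complex.norm_real]
        exact pow_le_one₀ (norm_nonneg _) (abs_le.2 ⟨ht.1.le, ht.2⟩)
      have h2 := hC t (Set.Ioc_subset_Icc_self ht)
      rw [norm_mul]
      refine mul_le_mul_of_nonneg_left ?_ (norm_nonneg _)
      rw [norm_mul]
      nlinarith [norm_nonneg ((t : ℂ) ^ n), norm_nonneg ((1 - (t : ℂ) ^ 2) ^ s)]
    · exact Filter.Eventually.of_forall fun t _ => (summable_norm_choose_mul_pow s hxn).mul_right C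
    · exact intervalIntegrable_const
    · refine Filter.Eventually.of_forall fun t ht => ?_
      rw [hIoc] at ht
      have hxt : ‖x * t‖ < 1 := by
        rw [norm_mul, Complex.norm_real]
        have : ‖t‖ ≤ 1 := abs_le.2 ⟨ht.1.le, ht.2⟩
        nlinarith [norm_nonneg x, norm_nonneg t]
      have h := (hasSum_one_add_cpow s hxt).mul_left ((1 - (t : ℂ) ^ 2) ^ s)
      rwa [show (fun n => (1 - (t : ℂ) ^ 2) ^ s * (Ring.choose s n * (x * t) ^ n)) =
        fun n => Ring.choose s n * x ^ n * ((t : ℂ) ^ n * (1 - (t : ℂ) ^ 2) ^ s) from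
        funext fun n => by rw [mul_pow]; ring] at h
  -- Odd moments vanish by parity, so the sum is reindexed over even exponents.
  have hinj : Function.Injective fun k : ℕ => 2 * k := fun i j h => by simpa using h
  rw [← hinj.hasSum_iff] at hsum
  · rw [← hsum.tsum_eq, ← tsum_mul_left]
    refine tsum_congr fun k => ?_
    have hch := choose_two_mul_mul_Gamma a k
    rw [Function.comp_apply, intervalIntegral.integral_const_mul,
      integral_even_pow_mul_one_sub_sq_cpow hs, pow_mul x, hx, regularizedTerm, div_eq_mul_inv,
      show (3 / 2 + s + k : ℂ) = 3 / 2 - 2 * a + k by rw [hsdef]; ring,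
      show s + 1 = 1 - 2 * a by rw [hsdef]; ring]
    linear_combination ((-1 / 3) ^ k * Complex.Gamma (1 - 2 * a) *
      (Complex.Gamma (3 / 2 - 2 * a + k))⁻¹) * hch
  · intro n hn
    have hodd : Odd n := by
      rw [← Nat.not_even_iff_odd]
      rintro ⟨j, rfl⟩
      exact hn ⟨j, by dsimp only; ring⟩
    rw [intervalIntegral.integral_const_mul, integral_pow_mul_one_sub_sq_cpow hs, hodd.neg_one_pow]
    simp

/-! ### Second evaluation: a chord between cube roots of unity -/

theorem integral_one_sub_cube_cpow {s : ℂ} (hs : 0 < s.re) :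
    ∫ r in (0 : ℝ)..1, (1 - (r : ℂ) ^ 3) ^ s =
      Complex.Gamma (4 / 3) * Complex.Gamma (1 + s) / Complex.Gamma (4 / 3 + s) := by
  have h := integral_pow_mul_one_sub_pow_cpow 0 three_pos s
  rw [Complex.betaIntegral_eq_Gamma_mul_div] at h
  · simp only [pow_zero, one_mul] at h
    rw [h]
    push_cast
    rw [show (4 / 3 : ℂ) = 1 / 3 + 1 by norm_num, Complex.Gamma_add_one (1 / 3) (by norm_num),
      zero_add, show (1 / 3 + (s + 1) : ℂ) = 1 / 3 + 1 + s by ring, add_comm s 1]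
    ring
  · norm_num
  · rw [Complex.add_re, Complex.one_re]
    positivity

/-- Cauchy's theorem replaces the chord by two radii, on which `(rp)³ = (rq)³ = r³`. For `‖z‖ < 1`
the number `1 - z³` has positive real part, so the principal power is holomorphic there; `Re s > 0`
gives continuity up to the circle. -/
theorem integral_one_sub_cube_cpow_segment {s p q : ℂ} (hs : 0 < s.re) (hp : p ^ 3 = 1)
    (hq : q ^ 3 = 1) :
    (q - p) * ∫ t in (0 : ℝ)..1, (1 - (p + t * (q - p)) ^ 3) ^ s =
      (q - p) * ∫ r in (0 : ℝ)..1, (1 - (r : ℂ) ^ 3) ^ s := by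
  have hnorm : ∀ {z : ℂ}, z ^ 3 = 1 → ‖z‖ ≤ 1 := fun hz =>
    (Complex.norm_eq_one_of_pow_eq_one hz three_ne_zero).le
  have hre : ∀ {z : ℂ}, 1 - ‖z‖ ^ 3 ≤ (1 - z ^ 3).re := by
    intro z
    have h := Complex.re_le_norm (z ^ 3)
    rw [norm_pow] at h
    simp only [Complex.sub_re, Complex.one_re]
    linarith
  have h := integral_segment_eq_sub_of_differentiableOn_ball (f := fun z => (1 - z ^ 3) ^ s)
    ?_ ?_ (hnorm hp) (hnorm hq)
  · simp only [mul_pow, hp, hq, mul_one] at h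
    rw [h]
    ring
  · intro z hz
    rw [mem_closedBall_zero_iff] at hz
    refine ContinuousAt.continuousWithinAt (ContinuousAt.comp (f := fun z : ℂ => 1 - z ^ 3)
      (Complex.continuousAt_cpow_const_of_re_pos (Or.inl ?_) hs) (by fun_prop))
    have := pow_le_one₀ (n := 3) (norm_nonneg z) hz
    linarith [hre (z := z)]
  · intro z hz
    rw [mem_ball_zero_iff] at hz
    refine DifferentiableAt.differentiableWithinAt (DifferentiableAt.cpow_const (by fun_prop) ?_)
    have := pow_lt_one₀ (norm_nonneg z) hz three_ne_zero
    exact Or.inl (by linarith [hre (z := z)])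

/-- A nonnegative real factor does not change the branch; `s ≠ 0` admits zero bases, which occur at
the endpoints of the chord. -/
theorem Complex.ofReal_mul_cpow {r : ℝ} (hr : 0 ≤ r) {z s : ℂ} (hs : s ≠ 0) :
    ((r : ℂ) * z) ^ s = (r : ℂ) ^ s * z ^ s := by
  rcases hr.eq_or_lt with rfl | hr
  · simp [Complex.zero_cpow hs]
  rcases eq_or_ne z 0 with rfl | hz
  · simp [Complex.zero_cpow hs]
  have hr' : (r : ℂ) ≠ 0 := by exact_mod_cast hr.ne'
  rw [Complex.cpow_def_of_ne_zero (mul_ne_zero hr' hz), Complex.log_ofReal_mul hr hz,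
    Complex.ofReal_log hr.le, add_mul, Complex.exp_add, ← Complex.cpow_def_of_ne_zero hr',
    ← Complex.cpow_def_of_ne_zero hz]

theorem integral_one_sub_sq_cpow_mul_one_add_cpow_eq_Gamma {s : ℂ} (hs : 0 < s.re) :
    ∃ x : ℂ, x ^ 2 = -1 / 3 ∧
      ∫ t in (-1 : ℝ)..1, (1 - (t : ℂ) ^ 2) ^ s * (1 + x * t) ^ s =
        2 * (8 / 9) ^ s *
          (Complex.Gamma (4 / 3) * Complex.Gamma (1 + s) / Complex.Gamma (4 / 3 + s)) := by
  have hs0 : s ≠ 0 := by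
    rintro rfl
    simp at hs
  obtain ⟨y, hy⟩ : ∃ y : ℂ, y ^ 2 = -3 := ⟨Complex.I * Real.sqrt 3, by
    rw [mul_pow, Complex.I_sq, ← Complex.ofReal_pow, Real.sq_sqrt zero_le_three]
    norm_num⟩
  have hy0 : y ≠ 0 := by
    rintro rfl
    norm_num at hy
  refine ⟨-y / 3, by linear_combination hy / 9, ?_⟩
  -- With `u = 2t - 1` the point of the chord is `z = (-1 + uy)/2`, and `y² = -3` gives `1 - z³ =
  -- (9/8)(1 - u²)(1 - uy/3)`; hence `x = -y/3`.
  have hseg := integral_one_sub_cube_cpow_segment (p := (-1 - y) / 2) (q := (-1 + y) / 2) hs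
    (by linear_combination (-(y + 3) / 8) * hy) (by linear_combination ((y - 3) / 8) * hy)
  rw [show (-1 + y) / 2 - (-1 - y) / 2 = y by ring, integral_one_sub_cube_cpow hs] at hseg
  have hseg' := mul_left_cancel₀ hy0 hseg
  have hsub := intervalIntegral.integral_comp_mul_sub (a := 0) (b := 1)
    (fun t : ℝ => (1 - (t : ℂ) ^ 2) ^ s * (1 + -y / 3 * t) ^ s) (two_ne_zero' ℝ) 1
  norm_num at hsub
  have hcongr : ∫ t in (0 : ℝ)..1, (1 - (2 * (t : ℂ) - 1) ^ 2) ^ s *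
      (1 + -y / 3 * (2 * (t : ℂ) - 1)) ^ s =
      ∫ t in (0 : ℝ)..1, (8 / 9) ^ s * (1 - ((-1 - y) / 2 + t * y) ^ 3) ^ s := by
    refine intervalIntegral.integral_congr fun t ht => ?_
    rw [Set.uIcc_of_le zero_le_one] at ht
    have h1 : (1 - (2 * (t : ℂ) - 1) ^ 2) = ((1 - (2 * t - 1) ^ 2 : ℝ) : ℂ) := by push_cast; ring
    have h2 : (8 / 9 : ℂ) = ((8 / 9 : ℝ) : ℂ) := by push_cast; ring
    rw [h1, h2, ← Complex.ofReal_mul_cpow (by nlinarith [ht.1, ht.2]) hs0,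
      ← Complex.ofReal_mul_cpow (by norm_num) hs0]
    congr 1
    push_cast
    linear_combination ((y * (2 * t - 1) ^ 3 - 3 * (2 * t - 1) ^ 2) / 9) * hy
  rw [intervalIntegral.integral_const_mul, hseg'] at hcongr
  rw [hcongr] at hsub
  linear_combination -2 * hsub

/-! ### Comparison and analytic continuation -/

theorem Complex.natCast_div_natCast_cpow {m n : ℕ} (hn : n ≠ 0) (z : ℂ) :
    ((m : ℂ) / n) ^ z = (m : ℂ) ^ z / (n : ℂ) ^ z := by
  have hn' : (n : ℂ) ≠ 0 := by exact_mod_cast hn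
  have hz : (n : ℂ) ^ z ≠ 0 := fun h => hn' ((Complex.cpow_eq_zero_iff _ _).1 h).1
  rw [eq_div_iff hz]
  have h := Complex.mul_cpow_ofReal_nonneg (a := m / n) (b := n) (by positivity) (by positivity) z
  push_cast at h
  rw [← h, div_mul_cancel₀ _ hn']

theorem tsum_regularizedTerm_of_re_neg {a : ℂ} (ha : a.re < 0) :
    ∑' k, regularizedTerm k a = (9 / 8 : ℂ) ^ (2 * a) * (2 * Complex.Gamma (4 / 3) /
      (Real.sqrt Real.pi : ℂ)) * (Complex.Gamma (4 / 3 - 2 * a))⁻¹ := by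
  have hs : 0 < (-2 * a).re := by
    simp
    linarith
  obtain ⟨x, hx, h⟩ := integral_one_sub_sq_cpow_mul_one_add_cpow_eq_Gamma hs
  rw [integral_one_sub_sq_cpow_mul_one_add_cpow ha hx, show 1 + -2 * a = 1 - 2 * a by ring,
    show 4 / 3 + -2 * a = 4 / 3 - 2 * a by ring] at h
  have hG : Complex.Gamma (1 - 2 * a) ≠ 0 := by
    refine Complex.Gamma_ne_zero_of_re_pos ?_
    simp
    linarith
  have hpi : (Real.sqrt Real.pi : ℂ) ≠ 0 := by
    exact_mod_cast (Real.sqrt_pos.2 Real.pi_pos).ne'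
  have hpow : (8 / 9 : ℂ) ^ (-2 * a) = (9 / 8 : ℂ) ^ (2 * a) := by
    have h1 := Complex.natCast_div_natCast_cpow (m := 8) (n := 9) (by norm_num) (2 * a)
    have h2 := Complex.natCast_div_natCast_cpow (m := 9) (n := 8) (by norm_num) (2 * a)
    push_cast at h1 h2
    rw [neg_mul, Complex.cpow_neg, h1, h2, inv_div]
  rw [hpow] at h
  refine mul_left_cancel₀ (mul_ne_zero hpi hG) (h.trans ?_)
  field_simp

theorem differentiable_const_cpow_two_mul {r : ℂ} (hr : r ≠ 0) :
    Differentiable ℂ fun a : ℂ => r ^ (2 * a) :=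
  fun _ => DifferentiableAt.const_cpow (by fun_prop) (Or.inl hr)

theorem tsum_regularizedTerm (a : ℂ) :
    ∑' k, regularizedTerm k a = (9 / 8 : ℂ) ^ (2 * a) * (2 * Complex.Gamma (4 / 3) /
      (Real.sqrt Real.pi : ℂ)) * (Complex.Gamma (4 / 3 - 2 * a))⁻¹ := by
  have hG : Differentiable ℂ fun a : ℂ => (Complex.Gamma (4 / 3 - 2 * a))⁻¹ :=
    Complex.differentiable_one_div_Gamma.comp (by fun_prop)
  have hR := ((differentiable_const_cpow_two_mul (r := 9 / 8) (by norm_num)).mul_const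
    (2 * Complex.Gamma (4 / 3) / (Real.sqrt Real.pi : ℂ))).mul hG
  refine congr_fun (AnalyticOnNhd.eq_of_eventuallyEq (z₀ := -1)
    (differentiable_tsum_regularizedTerm.differentiableOn.analyticOnNhd isOpen_univ)
    (hR.differentiableOn.analyticOnNhd isOpen_univ) ?_) a
  have hopen : IsOpen {z : ℂ | z.re < 0} := isOpen_lt Complex.continuous_re continuous_const
  filter_upwards [hopen.mem_nhds (by simp : (-1 : ℂ).re < 0)] with z hz
  exact tsum_regularizedTerm_of_re_neg hz

theorem hypergeometric_neg_third_eq (a : ℂ) (hc : ∀ k : ℕ, 3 / 2 - 2 * a ≠ -(k : ℂ)) :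
    ₂F₁ a (a + 1 / 2) (3 / 2 - 2 * a) (-1 / 3 : ℂ) =
      (9 / 8 : ℂ) ^ (2 * a) *
        (2 * Complex.Gamma (3 / 2 - 2 * a) * Complex.Gamma (4 / 3) /
          ((Real.sqrt Real.pi : ℂ) * Complex.Gamma (4 / 3 - 2 * a))) := by
  have h := Gamma_inv_mul_hypergeometric_eq_tsum a hc
  rw [tsum_regularizedTerm, inv_mul_eq_iff_eq_mul₀ (Complex.Gamma_ne_zero hc)] at h
  rw [h, ← div_div]
  ring

/-! ### The two closed forms -/

theorem Gamma_quotient_eq {a : ℂ} (h1 : Complex.Gamma (2 / 3 - 2 * a) ≠ 0)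
    (h2 : Complex.Gamma (2 - 4 * a) ≠ 0) :
    Complex.Gamma (2 / 3 - 2 * a) * Complex.Gamma (2 - 4 * a) /
      ((6 : ℂ) ^ (2 * a) * Complex.Gamma (2 / 3) * Complex.Gamma (2 - 6 * a)) =
      (9 / 8 : ℂ) ^ (2 * a) *
        (2 * Complex.Gamma (3 / 2 - 2 * a) * Complex.Gamma (4 / 3) /
          ((Real.sqrt Real.pi : ℂ) * Complex.Gamma (4 / 3 - 2 * a))) := by
  have hpi : (Real.sqrt Real.pi : ℂ) ≠ 0 := by
    exact_mod_cast (Real.sqrt_pos.2 Real.pi_pos).ne'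
  have hdup := Complex.Gamma_mul_Gamma_add_half (1 - 2 * a)
  have htrip := Complex.Gamma_mul_Gamma_add_third_mul_Gamma_add_two_thirds (2 / 3 - 2 * a)
  rw [show 1 - 2 * a + 1 / 2 = 3 / 2 - 2 * a by ring, show 2 * (1 - 2 * a) = 2 - 4 * a by ring,
    show 1 - (2 - 4 * a) = 4 * a - 1 by ring] at hdup
  rw [show 2 / 3 - 2 * a + 1 / 3 = 1 - 2 * a by ring,
    show 2 / 3 - 2 * a + 2 / 3 = 4 / 3 - 2 * a by ring,
    show 3 * (2 / 3 - 2 * a) = 2 - 6 * a by ring,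
    show 1 - (2 - 6 * a) = 6 * a - 1 by ring] at htrip
  have hthird : Complex.Gamma (4 / 3) = 1 / 3 * Complex.Gamma (1 / 3) := by
    rw [show (4 / 3 : ℂ) = 1 / 3 + 1 by norm_num, Complex.Gamma_add_one _ (by norm_num)]
  have hpow : (9 / 8 : ℂ) ^ (2 * a) * (2 : ℂ) ^ (4 * a) * (6 : ℂ) ^ (2 * a) = (3 : ℂ) ^ (6 * a) := by
    have e1 := Complex.natCast_mul_natCast_cpow 3 3 (2 * a)
    have e2 := Complex.natCast_mul_natCast_cpow 2 4 (2 * a)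
    have e3 := Complex.natCast_mul_natCast_cpow 2 2 (2 * a)
    have e4 := Complex.natCast_mul_natCast_cpow 2 3 (2 * a)
    have e5 := Complex.natCast_div_natCast_cpow (m := 9) (n := 8) (by norm_num) (2 * a)
    norm_num at e1 e2 e3 e4 e5
    have h2 : (2 : ℂ) ^ (2 * a) ≠ 0 := by simp [Complex.cpow_eq_zero_iff]
    rw [e5, e1, e2, e3, e4, show 4 * a = 2 * a + 2 * a by ring,
      show 6 * a = 2 * a + 2 * a + 2 * a by ring, Complex.cpow_add _ _ two_ne_zero,
      Complex.cpow_add _ _ three_ne_zero, Complex.cpow_add _ _ three_ne_zero]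
    field_simp
  rw [Complex.cpow_sub _ _ two_ne_zero, Complex.cpow_one] at hdup
  rw [Complex.cpow_sub _ _ three_ne_zero, Complex.cpow_one] at htrip
  have h24 : (2 : ℂ) ^ (4 * a) ≠ 0 := by simp [Complex.cpow_eq_zero_iff]
  have h36 : (3 : ℂ) ^ (6 * a) ≠ 0 := by simp [Complex.cpow_eq_zero_iff]
  have h62 : (6 : ℂ) ^ (2 * a) ≠ 0 := by simp [Complex.cpow_eq_zero_iff]
  have hg1 : Complex.Gamma (1 / 3) ≠ 0 := Complex.Gamma_ne_zero_of_re_pos (by norm_num)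
  have hg2 : Complex.Gamma (2 / 3) ≠ 0 := Complex.Gamma_ne_zero_of_re_pos (by norm_num)
  rw [hthird]
  generalize Complex.Gamma (2 / 3 - 2 * a) = A at *
  generalize Complex.Gamma (2 - 4 * a) = B at *
  generalize Complex.Gamma (1 - 2 * a) = C at *
  generalize Complex.Gamma (3 / 2 - 2 * a) = D at *
  generalize Complex.Gamma (4 / 3 - 2 * a) = E at *
  generalize Complex.Gamma (2 - 6 * a) = F at *
  generalize Complex.Gamma (1 / 3) = G at *
  generalize Complex.Gamma (2 / 3) = H at *
  generalize (2 : ℂ) ^ (4 * a) = x at *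
  generalize (3 : ℂ) ^ (6 * a) = y at *
  generalize (6 : ℂ) ^ (2 * a) = z at *
  generalize (9 / 8 : ℂ) ^ (2 * a) = w at *
  generalize (Real.sqrt Real.pi : ℂ) = p at *
  have hCD : C * D ≠ 0 := by
    rw [hdup]
    simp [h2, h24, hpi]
  have hC : C ≠ 0 := left_ne_zero_of_mul hCD
  -- `Γ` is `0` at its poles here. A pole of `Γ(4/3 - 2a)` is also one of `Γ(2 - 6a)`, and division
  -- by zero makes both sides `0`, matching `1/Γ = 0`.
  rcases eq_or_ne E 0 with rfl | hE
  · have hF : F = 0 := by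
      rw [mul_zero, eq_comm] at htrip
      simpa [h36, hg1, hg2] using htrip
    simp [hF]
  · have hF : F ≠ 0 := by
      rintro rfl
      simp [h1, hC, hE] at htrip
    rw [div_eq_iff (by simp [h62, hg2, hF])]
    have key : 3 * A * B * p * E = 2 * w * D * G * z * H * F :=
      mul_left_cancel₀ (mul_ne_zero hC h24) (by
        linear_combination 3 * B * p * x * htrip - 2 * x * w * G * z * H * F * hdup -
          B * p * x * F * G * H * hpow)
    field_simp
    linear_combination key

/-- The zeros of the entire function `1/Γ` are isolated: it is not identically zero, as the point
`(b - 1)/c` with value `1/Γ(1) = 1` shows. -/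
theorem eventually_Gamma_const_sub_mul_ne_zero (b a : ℂ) {c : ℂ} (hc : c ≠ 0) :
    ∀ᶠ z in 𝓝[≠] a, Complex.Gamma (b - c * z) ≠ 0 := by
  have hd : Differentiable ℂ fun z : ℂ => (Complex.Gamma (b - c * z))⁻¹ :=
    Complex.differentiable_one_div_Gamma.comp (by fun_prop)
  have han := hd.differentiableOn.analyticOnNhd isOpen_univ
  rcases (han a (Set.mem_univ a)).eventually_eq_zero_or_eventually_ne_zero with h | h
  · have h0 := han.eqOn_zero_of_preconnected_of_eventuallyEq_zero isPreconnected_univ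
      (Set.mem_univ a) h (Set.mem_univ ((b - 1) / c))
    simp [mul_div_cancel₀ _ hc] at h0
  · filter_upwards [h] with z hz h'
    exact hz (by rw [h', inv_zero])

theorem mainTheorem4 (a : ℂ) (hc : ∀ k : ℕ, 3 / 2 - 2 * a ≠ -(k : ℂ)) :
    -- first closed form, wherever the gamma functions in its numerator have no pole
    ((∀ k : ℕ, 2 / 3 - 2 * a ≠ -(k : ℂ)) → (∀ k : ℕ, 2 - 4 * a ≠ -(k : ℂ)) →
      ₂F₁ a (a + 1 / 2) (3 / 2 - 2 * a) (-1 / 3 : ℂ) =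
        Complex.Gamma (2 / 3 - 2 * a) * Complex.Gamma (2 - 4 * a) /
          ((6 : ℂ) ^ (2 * a) * Complex.Gamma (2 / 3) * Complex.Gamma (2 - 6 * a))) ∧
    -- first closed form as a limit, which gives its value at the removable singularities too
    Filter.Tendsto
      (fun z : ℂ => Complex.Gamma (2 / 3 - 2 * z) * Complex.Gamma (2 - 4 * z) /
          ((6 : ℂ) ^ (2 * z) * Complex.Gamma (2 / 3) * Complex.Gamma (2 - 6 * z)))
      (𝓝[≠] a) (𝓝 (₂F₁ a (a + 1 / 2) (3 / 2 - 2 * a) (-1 / 3 : ℂ))) ∧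
    -- second closed form, with no further restriction on the parameter
    ₂F₁ a (a + 1 / 2) (3 / 2 - 2 * a) (-1 / 3 : ℂ) =
      (9 / 8 : ℂ) ^ (2 * a) *
        (2 * Complex.Gamma (3 / 2 - 2 * a) * Complex.Gamma (4 / 3) /
          ((Real.sqrt Real.pi : ℂ) * Complex.Gamma (4 / 3 - 2 * a))) := by
  have hF := hypergeometric_neg_third_eq a hc
  refine ⟨fun h1 h2 => ?_, ?_, hF⟩
  · rw [hF, Gamma_quotient_eq (Complex.Gamma_ne_zero h1) (Complex.Gamma_ne_zero h2)]
  · have hG1 : ContinuousAt (fun z : ℂ => Complex.Gamma (3 / 2 - 2 * z)) a :=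
      ContinuousAt.comp (f := fun z : ℂ => 3 / 2 - 2 * z)
        (Complex.differentiableAt_Gamma _ hc).continuousAt (by fun_prop)
    -- Continuity is needed for `1/Γ`, not `Γ`, since `a` may be a pole of `Γ(4/3 - 2a)`.
    have hG2 : Continuous fun z : ℂ => (Complex.Gamma (4 / 3 - 2 * z))⁻¹ :=
      Complex.differentiable_one_div_Gamma.continuous.comp (by fun_prop)
    have hp : Continuous fun z : ℂ => (9 / 8 : ℂ) ^ (2 * z) :=
      (differentiable_const_cpow_two_mul (by norm_num)).continuous
    have hcont : ContinuousAt (fun z : ℂ => (9 / 8 : ℂ) ^ (2 * z) *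
        (2 * Complex.Gamma (3 / 2 - 2 * z) * Complex.Gamma (4 / 3) /
          ((Real.sqrt Real.pi : ℂ) * Complex.Gamma (4 / 3 - 2 * z)))) a := by
      simp only [div_eq_mul_inv, mul_inv]
      exact hp.continuousAt.mul (((continuousAt_const.mul hG1).mul continuousAt_const).mul
        (continuousAt_const.mul hG2.continuousAt))
    rw [hF]
    refine (hcont.tendsto.mono_left nhdsWithin_le_nhds).congr' ?_
    filter_upwards [eventually_Gamma_const_sub_mul_ne_zero (2 / 3) a two_ne_zero,
      eventually_Gamma_const_sub_mul_ne_zero 2 a (c := 4) (by norm_num)] with z h1 h2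
    exact (Gamma_quotient_eq h1 h2).symm
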